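/- Let $N\ge 2$, let $\Omega\subset\mathbb{R}^N$ be a bounded domain (a nonempty, bounded, connected open set), and let $s\in(0,1)$. For measurable $u:\mathbb{R}^N\to\mathbb{R}$ set \[ [u]_s=\Big(\iint_{\mathbb{R}^N\times\mathbb{R}^N}\frac{|u(x)-u(y)|^2}{|x-y|^{N+2s}}\,dx\,dy\Big)^{1/2}\in[0,\infty]. \] Let \[ X=\{u\in H^1(\mathbb{R}^N):\ u=0\ \text{a.e. in}\ \mathbb{R}^N\setminus\Omega\},\qquad \|u\|_X=\|\nabla u\|_{L^2(\mathbb{R}^N)}, \] where $H^1(\mathbb{R}^N)$ is the space of real-valued $u\in L^2(\mathbb{R}^N)$ whose weak gradient $\nabla u$ lies in $L^2(\mathbb{R}^N;\mathbb{R}^N)$ (if $\partial\Omega$ is of class $C^1$, then $X$ consists of the extensions by $0$ of the functions in $H^1_0(\Omega)$), and let \[ Y=\{u\in L^2(\mathbb{R}^N):\ [u]_s<\infty,\ u=0\ \text{a.e. in}\ \mathbb{R}^N\setminus\Omega\},\qquad \|u\|_Y=[u]_s. \] Then $X$ is compactly embedded into $Y$: $X\subset Y$, and the inclusion map $X\to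 Y$, $u\mapsto u$, is a continuous and compact linear operator with respect to the norms $\|\cdot\|_X$ and $\|\cdot\|_Y$. -/

import Mathlib

noncomputable section

namespace MixedSobolev

open MeasureTheory Filter Topology
open scoped ENNReal ContDiff

/-- Euclidean space `ℝ^N`. -/
abbrev E (N : ℕ) : Type := EuclideanSpace ℝ (Fin N)

/-- The real Lebesgue space `L²(ℝ^N)`. -/
abbrev L2 (N : ℕ) : Type := Lp ℝ 2 (volume : Measure (E N))

/-- The space `L²(ℝ^N; ℝ^N)` of square integrable vector fields. -/
abbrev L2Vec (N : ℕ) : Type := Lp (E N) 2 (volume : Measure (E N))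

/-- `G` is the weak gradient of `u`: for every test function `φ ∈ C_c^∞(ℝ^N)` and every `i`,
`∫ u ∂ᵢφ = - ∫ Gᵢ φ`. -/
def IsWeakGradient {N : ℕ} (u : L2 N) (G : L2Vec N) : Prop :=
  ∀ φ : E N → ℝ, ContDiff ℝ ∞ φ → HasCompactSupport φ → ∀ i : Fin N,
    ∫ x, u x * fderiv ℝ φ x (EuclideanSpace.single i 1) = -∫ x, G x i * φ x

/-- `[u]_s = (∬ |u(x) - u(y)|² / |x - y|^(N + 2s) dx dy)^(1/2)`, as an element of `[0, ∞]`. -/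
def gagliardo {N : ℕ} (s : ℝ) (u : E N → ℝ) : ℝ≥0∞ :=
  (∫⁻ p : E N × E N, ‖u p.1 - u p.2‖ₑ ^ (2 : ℝ) / ‖p.1 - p.2‖ₑ ^ ((N : ℝ) + 2 * s)) ^ (1 / 2 : ℝ)

/-! ### Facts needed for the vector space structures and the norms -/

section WeakGradient

variable {N : ℕ}

theorem integrable_mul_test {u : E N → ℝ} (hu : MemLp u 2 volume) {ψ : E N → ℝ}
    (hψ : Continuous ψ) (hc : HasCompactSupport ψ) : Integrable (fun x => u x * ψ x) :=
  hu.integrable_mul (q := 2) (hψ.memLp_of_hasCompactSupport hc)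

theorem memLp_coord (G : L2Vec N) (i : Fin N) : MemLp (fun x => G x i) 2 volume :=
  (EuclideanSpace.proj i : E N →L[ℝ] ℝ).comp_memLp' (Lp.memLp G)

theorem continuous_partial {φ : E N → ℝ} (hφ : ContDiff ℝ ∞ φ) (v : E N) :
    Continuous (fun x => fderiv ℝ φ x v) :=
  (hφ.continuous_fderiv (by simp)).clm_apply continuous_const

theorem hasCompactSupport_partial {φ : E N → ℝ} (hc : HasCompactSupport φ) (v : E N) :
    HasCompactSupport (fun x => fderiv ℝ φ x v) :=
  hc.fderiv_apply (𝕜 := ℝ) v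

theorem IsWeakGradient.add {u v : L2 N} {G H : L2Vec N} (hu : IsWeakGradient u G)
    (hv : IsWeakGradient v H) : IsWeakGradient (u + v) (G + H) := by
  intro φ hφ hc i
  have h1 : ∫ x, (u + v : L2 N) x * fderiv ℝ φ x (EuclideanSpace.single i 1)
      = ∫ x, (u x * fderiv ℝ φ x (EuclideanSpace.single i 1)
          + v x * fderiv ℝ φ x (EuclideanSpace.single i 1)) := by
    refine integral_congr_ae ?_
    filter_upwards [Lp.coeFn_add u v] with x hx
    rw [hx, Pi.add_apply, add_mul]
  have h2 : ∫ x, (G + H : L2Vec N) x i * φ x = ∫ x, (G x i * φ x + H x i * φ x) := by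
    refine integral_congr_ae ?_
    filter_upwards [Lp.coeFn_add G H] with x hx
    rw [hx, Pi.add_apply, PiLp.add_apply, add_mul]
  rw [h1, h2, integral_add, integral_add, hu φ hφ hc i, hv φ hφ hc i, neg_add]
  · exact integrable_mul_test (memLp_coord G i) hφ.continuous hc
  · exact integrable_mul_test (memLp_coord H i) hφ.continuous hc
  · exact integrable_mul_test (Lp.memLp u) (continuous_partial hφ _)
      (hasCompactSupport_partial hc _)
  · exact integrable_mul_test (Lp.memLp v) (continuous_partial hφ _)
      (hasCompactSupport_partial hc _)

theorem IsWeakGradient.smul {u : L2 N} {G : L2Vec N} (c : ℝ) (hu : IsWeakGradient u G) :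
    IsWeakGradient (c • u) (c • G) := by
  intro φ hφ hc i
  have h1 : ∫ x, (c • u : L2 N) x * fderiv ℝ φ x (EuclideanSpace.single i 1)
      = ∫ x, c * (u x * fderiv ℝ φ x (EuclideanSpace.single i 1)) := by
    refine integral_congr_ae ?_
    filter_upwards [Lp.coeFn_smul c u] with x hx
    rw [hx, Pi.smul_apply, smul_eq_mul, mul_assoc]
  have h2 : ∫ x, (c • G : L2Vec N) x i * φ x = ∫ x, c * (G x i * φ x) := by
    refine integral_congr_ae ?_
    filter_upwards [Lp.coeFn_smul c G] with x hx
    rw [hx, Pi.smul_apply, PiLp.smul_apply, smul_eq_mul, mul_assoc]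
  rw [h1, h2, integral_const_mul, integral_const_mul, hu φ hφ hc i, mul_neg]

/-- Weak gradients are unique. -/
theorem IsWeakGradient.unique {u : L2 N} {G H : L2Vec N} (hG : IsWeakGradient u G)
    (hH : IsWeakGradient u H) : G = H := by
  have key : ∀ i : Fin N, ∀ᵐ x ∂(volume : Measure (E N)), G x i = H x i := by
    intro i
    refine ae_eq_of_integral_contDiff_smul_eq
      ((memLp_coord G i).locallyIntegrable (by norm_num))
      ((memLp_coord H i).locallyIntegrable (by norm_num)) ?_
    intro φ hφ hc
    have := (hG φ hφ hc i).symm.trans (hH φ hφ hc i)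
    simpa [mul_comm] using this
  refine Lp.ext ?_
  filter_upwards [ae_all_iff.2 key] with x hx
  ext i
  exact hx i

end WeakGradient

section Gagliardo

variable {N : ℕ}

theorem gagliardo_congr (s : ℝ) {u v : E N → ℝ} (h : u =ᵐ[volume] v) :
    gagliardo s u = gagliardo s v := by
  unfold gagliardo
  congr 1
  refine lintegral_congr_ae ?_
  have h1 : ∀ᵐ p : E N × E N, u p.1 = v p.1 := Measure.quasiMeasurePreserving_fst.ae h
  have h2 : ∀ᵐ p : E N × E N, u p.2 = v p.2 := Measure.quasiMeasurePreserving_snd.ae h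
  filter_upwards [h1, h2] with p hp hq
  rw [hp, hq]

theorem gagliardo_zero (s : ℝ) : gagliardo s (0 : E N → ℝ) = 0 := by
  simp [gagliardo]

theorem gagliardo_eq (s : ℝ) (u : E N → ℝ) :
    gagliardo s u = (∫⁻ p : E N × E N, (‖u p.1 - u p.2‖ₑ *
      (‖p.1 - p.2‖ₑ ^ ((N : ℝ) + 2 * s))⁻¹ ^ (1 / 2 : ℝ)) ^ (2 : ℝ)) ^ (1 / 2 : ℝ) := by
  unfold gagliardo
  congr 2
  ext p
  rw [ENNReal.mul_rpow_of_nonneg _ _ (by norm_num), ← ENNReal.rpow_mul, div_eq_mul_inv]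
  norm_num

theorem gagliardo_add_le (s : ℝ) {u v : E N → ℝ} (hu : AEStronglyMeasurable u volume)
    (hv : AEStronglyMeasurable v volume) :
    gagliardo s (u + v) ≤ gagliardo s u + gagliardo s v := by
  have hm : ∀ w : E N → ℝ, AEStronglyMeasurable w volume →
      AEMeasurable (fun p : E N × E N => ‖w p.1 - w p.2‖ₑ *
        (‖p.1 - p.2‖ₑ ^ ((N : ℝ) + 2 * s))⁻¹ ^ (1 / 2 : ℝ)) volume := by
    intro w hw
    have h1 : AEStronglyMeasurable (fun p : E N × E N => w p.1) volume :=
      hw.comp_quasiMeasurePreserving Measure.quasiMeasurePreserving_fst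
    have h2 : AEStronglyMeasurable (fun p : E N × E N => w p.2) volume :=
      hw.comp_quasiMeasurePreserving Measure.quasiMeasurePreserving_snd
    refine (h1.sub h2).enorm.mul ?_
    fun_prop
  rw [gagliardo_eq, gagliardo_eq, gagliardo_eq]
  refine le_trans ?_ (ENNReal.lintegral_Lp_add_le (p := 2) (hm u hu) (hm v hv) (by norm_num))
  gcongr with p
  refine le_trans ?_ (le_of_eq (add_mul _ _ _))
  gcongr
  calc ‖(u + v) p.1 - (u + v) p.2‖ₑ = ‖(u p.1 - u p.2) + (v p.1 - v p.2)‖ₑ := by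
        congr 1
        simp only [Pi.add_apply]
        ring
    _ ≤ _ := enorm_add_le _ _

theorem gagliardo_smul (s c : ℝ) (u : E N → ℝ) :
    gagliardo s (c • u) = ‖c‖ₑ * gagliardo s u := by
  unfold gagliardo
  have : ∀ p : E N × E N,
      ‖(c • u) p.1 - (c • u) p.2‖ₑ ^ (2 : ℝ) / ‖p.1 - p.2‖ₑ ^ ((N : ℝ) + 2 * s)
      = ‖c‖ₑ ^ (2 : ℝ) * (‖u p.1 - u p.2‖ₑ ^ (2 : ℝ) / ‖p.1 - p.2‖ₑ ^ ((N : ℝ) + 2 * s)) := by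
    intro p
    rw [Pi.smul_apply, Pi.smul_apply, ← smul_sub, smul_eq_mul, enorm_mul,
      ENNReal.mul_rpow_of_nonneg _ _ (by norm_num), mul_div_assoc]
  simp_rw [this]
  rw [lintegral_const_mul' _ _ (by simp),
    ENNReal.mul_rpow_of_nonneg _ _ (by norm_num), ← ENNReal.rpow_mul]
  norm_num

theorem gagliardo_lp_add_le (s : ℝ) (u v : L2 N) :
    gagliardo s (u + v : L2 N) ≤ gagliardo s u + gagliardo s v := by
  rw [gagliardo_congr s (Lp.coeFn_add u v)]
  exact gagliardo_add_le s (Lp.aestronglyMeasurable u) (Lp.aestronglyMeasurable v)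

theorem gagliardo_lp_smul (s c : ℝ) (u : L2 N) :
    gagliardo s (c • u : L2 N) = ‖c‖ₑ * gagliardo s u := by
  rw [gagliardo_congr s (Lp.coeFn_smul c u)]
  exact gagliardo_smul s c u

theorem gagliardo_lp_zero (s : ℝ) : gagliardo s (0 : L2 N) = 0 := by
  rw [gagliardo_congr s (Lp.coeFn_zero ℝ 2 volume), gagliardo_zero]

end Gagliardo

/-! ### The spaces -/

/-- `H¹(ℝ^N)`: the functions in `L²(ℝ^N)` with a weak gradient in `L²`. -/
def H1 (N : ℕ) : Submodule ℝ (L2 N) where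
  carrier := {u | ∃ G : L2Vec N, IsWeakGradient u G}
  add_mem' := fun ⟨G, hG⟩ ⟨H, hH⟩ => ⟨G + H, hG.add hH⟩
  zero_mem' := ⟨0, fun φ hφ hc i => by
    have h1 : ∫ x, (0 : L2 N) x * fderiv ℝ φ x (EuclideanSpace.single i 1) = 0 := by
      refine integral_eq_zero_of_ae ?_
      filter_upwards [Lp.coeFn_zero ℝ 2 (volume : Measure (E N))] with x hx
      rw [hx]; simp
    have h2 : ∫ x, (0 : L2Vec N) x i * φ x = 0 := by
      refine integral_eq_zero_of_ae ?_
      filter_upwards [Lp.coeFn_zero (E N) 2 (volume : Measure (E N))] with x hx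
      rw [hx]; simp
    rw [h1, h2, neg_zero]⟩
  smul_mem' := fun c _ ⟨G, hG⟩ => ⟨c • G, hG.smul c⟩

/-- `H^s(ℝ^N)`: the functions in `L²(ℝ^N)` with `[u]_s < ∞`. -/
def Hs (N : ℕ) (s : ℝ) : Submodule ℝ (L2 N) where
  carrier := {u | gagliardo s u < ⊤}
  add_mem' := fun {u v} hu hv =>
    (gagliardo_lp_add_le s u v).trans_lt (ENNReal.add_lt_top.2 ⟨hu, hv⟩)
  zero_mem' := (gagliardo_lp_zero s).trans_lt ENNReal.zero_lt_top
  smul_mem' := fun c u hu => by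
    simp only [Set.mem_ofPred_eq, gagliardo_lp_smul] at hu ⊢
    exact ENNReal.mul_lt_top enorm_lt_top hu

/-- The functions in `L²(ℝ^N)` that vanish a.e. in the complement of `Ω`. -/
def vanishingOutside {N : ℕ} (Ω : Set (E N)) : Submodule ℝ (L2 N) where
  carrier := {u | ∀ᵐ x, x ∉ Ω → u x = 0}
  add_mem' := fun {u v} hu hv => by
    filter_upwards [hu, hv, Lp.coeFn_add u v] with x h1 h2 h3 hx
    rw [h3, Pi.add_apply, h1 hx, h2 hx, add_zero]
  zero_mem' := by
    filter_upwards [Lp.coeFn_zero ℝ 2 (volume : Measure (E N))] with x h1 _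
    rw [h1, Pi.zero_apply]
  smul_mem' := fun c u hu => by
    filter_upwards [hu, Lp.coeFn_smul c u] with x h1 h2 hx
    rw [h2, Pi.smul_apply, h1 hx, smul_zero]

/-- The space `X = {u ∈ H¹(ℝ^N) : u = 0 a.e. in Ωᶜ}`. It carries the norm `‖∇u‖₂` below, and not
the norm of `L²(ℝ^N)`. -/
def X {N : ℕ} (Ω : Set (E N)) : Type := ↥(H1 N ⊓ vanishingOutside Ω)

/-- The space `Y = {u ∈ H^s(ℝ^N) : u = 0 a.e. in Ωᶜ}`. It carries the norm `[u]_s` below, and not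
the norm of `L²(ℝ^N)`. -/
def Y {N : ℕ} (s : ℝ) (Ω : Set (E N)) : Type := ↥(Hs N s ⊓ vanishingOutside Ω)

section Norms

variable {N : ℕ} {s : ℝ} {Ω : Set (E N)}

instance : AddCommGroup (X Ω) := inferInstanceAs (AddCommGroup ↥(H1 N ⊓ vanishingOutside Ω))

instance : Module ℝ (X Ω) := inferInstanceAs (Module ℝ ↥(H1 N ⊓ vanishingOutside Ω))

instance : AddCommGroup (Y s Ω) := inferInstanceAs (AddCommGroup ↥(Hs N s ⊓ vanishingOutside Ω))

instance : Module ℝ (Y s Ω) := inferInstanceAs (Module ℝ ↥(Hs N s ⊓ vanishingOutside Ω))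

/-- The element of `L²(ℝ^N)` underlying an element of `X`. -/
def X.toL2 (u : X Ω) : L2 N := Subtype.val u

/-- The element of `L²(ℝ^N)` underlying an element of `Y`. -/
def Y.toL2 (u : Y s Ω) : L2 N := Subtype.val u

/-- The weak gradient of an element of `X`. -/
def X.grad (u : X Ω) : L2Vec N := Classical.choose u.2.1

theorem X.isWeakGradient_grad (u : X Ω) : IsWeakGradient u.toL2 u.grad :=
  Classical.choose_spec u.2.1

theorem X.grad_add (u v : X Ω) : (u + v).grad = u.grad + v.grad :=
  (u + v).isWeakGradient_grad.unique (u.isWeakGradient_grad.add v.isWeakGradient_grad)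

theorem X.grad_smul (c : ℝ) (u : X Ω) : (c • u).grad = c • u.grad :=
  (c • u).isWeakGradient_grad.unique (u.isWeakGradient_grad.smul c)

/-- `‖u‖ = ‖∇u‖₂` on `X`. -/
instance : Norm (X Ω) := ⟨fun u => ‖u.grad‖⟩

/-- `‖u‖ = [u]_s` on `Y`, where it is finite. -/
instance : Norm (Y s Ω) := ⟨fun u => (gagliardo s u.toL2).toReal⟩

theorem X.core : SeminormedSpace.Core ℝ (X Ω) where
  norm_nonneg u := norm_nonneg u.grad
  norm_smul c u := by
    change ‖(c • u).grad‖ = ‖c‖ * ‖u.grad‖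
    rw [X.grad_smul, norm_smul]
  norm_triangle u v := by
    change ‖(u + v).grad‖ ≤ ‖u.grad‖ + ‖v.grad‖
    rw [X.grad_add]
    exact norm_add_le _ _

theorem Y.core : SeminormedSpace.Core ℝ (Y s Ω) where
  norm_nonneg u := ENNReal.toReal_nonneg
  norm_smul c u := by
    change (gagliardo s (c • u.toL2 : L2 N)).toReal = ‖c‖ * (gagliardo s u.toL2).toReal
    rw [gagliardo_lp_smul, ENNReal.toReal_mul, toReal_enorm]
  norm_triangle u v := by
    change (gagliardo s (u.toL2 + v.toL2 : L2 N)).toReal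
      ≤ (gagliardo s u.toL2).toReal + (gagliardo s v.toL2).toReal
    have hu : gagliardo s u.toL2 ≠ ⊤ := ne_of_lt u.2.1
    have hv : gagliardo s v.toL2 ≠ ⊤ := ne_of_lt v.2.1
    rw [← ENNReal.toReal_add hu hv]
    exact ENNReal.toReal_mono (ENNReal.add_ne_top.2 ⟨hu, hv⟩) (gagliardo_lp_add_le s _ _)

/-- The topology and metric of `X` come from `‖∇u‖₂`. This needs no assumption on `Ω`; for bounded
`Ω` (and `N ≥ 1`) the seminorm is a norm. -/
instance : SeminormedAddCommGroup (X Ω) := SeminormedAddCommGroup.ofCore (𝕜 := ℝ) X.core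

instance : NormedSpace ℝ (X Ω) where
  norm_smul_le c u := (X.core.norm_smul c u).le

/-- The topology and metric of `Y` come from `[u]_s`. This needs no assumption on `Ω`; for bounded
`Ω` (and `N ≥ 1`) the seminorm is a norm. -/
instance : SeminormedAddCommGroup (Y s Ω) := SeminormedAddCommGroup.ofCore (𝕜 := ℝ) Y.core

instance : NormedSpace ℝ (Y s Ω) where
  norm_smul_le c u := (Y.core.norm_smul c u).le

end Norms

end MixedSobolev

end

/-! The argument interpolates between translation estimates. Tonelli gives `[u]_s² = ∫ ‖u(· + h) -
u‖₂² |h|^(-N-2s) dh` (`gagliardo_rpow_two`), and the inner norm has two bounds: `|h| ‖∇u‖₂`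
(`IsWeakGradient.norm_translate_sub_le`) and `2 ‖u‖₂`. Using the first for `|h| < r` and the second
for `|h| ≥ r` yields `[u]_s² ≤ A(r) ‖∇u‖₂² + 4 B(r) ‖u‖₂²` (`IsWeakGradient.gagliardo_rpow_two_le`).
Here `A(r) → 0` as `r → 0` because `s < 1`, and `B(r) < ∞` because `s > 0`. Hence `X ⊆ Y`, and on
bounded subsets of `X` smallness in `L²` forces smallness of `[·]_s`.

Compactness therefore reduces to Rellich's theorem in `L²` (`totallyBounded_gradBall`). The
translation estimate shows that averaging over cubes of side `ε` changes `u` by `O(ε) ‖∇u‖₂` in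
`L²`; only finitely many cubes meet `Ω`, so the unit ball of `X` is uniformly close to
finite-dimensional spaces, and it is bounded by Poincaré's inequality. So the image of the unit ball
is totally bounded in `Y`. Since `Y` is complete (`Y.completeSpace`), its closure is compact.
Continuity follows from compactness. -/

noncomputable section

namespace MixedSobolev

open MeasureTheory Filter Topology
open scoped ENNReal ContDiff Convolution

/-! ### Translation estimates in `L²` from a weak gradient. -/

section Translation

variable {N : ℕ}

theorem enorm_lp_rpow_two {F : Type*} [NormedAddCommGroup F] (f : Lp F 2 (volume : Measure (E N))) :
    ‖f‖ₑ ^ (2 : ℝ) = ∫⁻ x, ‖f x‖ₑ ^ (2 : ℝ) := by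
  rw [Lp.enorm_def, eLpNorm_eq_lintegral_rpow_enorm_toReal (by norm_num) (by norm_num),
    ← ENNReal.rpow_mul]
  simp

/-- The defining identity of the weak gradient, in an arbitrary direction. -/
theorem IsWeakGradient.integral_fderiv {u : L2 N} {G : L2Vec N} (hG : IsWeakGradient u G)
    {φ : E N → ℝ} (hφ : ContDiff ℝ ∞ φ) (hc : HasCompactSupport φ) (v : E N) :
    ∫ x, u x * fderiv ℝ φ x v = -∫ x, inner ℝ v (G x) * φ x := by
  have hv : v = ∑ i, v i • EuclideanSpace.single i (1 : ℝ) := by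
    simpa using ((EuclideanSpace.basisFun (Fin N) ℝ).sum_repr v).symm
  have h1 : ∀ x, u x * fderiv ℝ φ x v
      = ∑ i, v i * (u x * fderiv ℝ φ x (EuclideanSpace.single i 1)) := by
    intro x
    conv_lhs => rw [hv]
    rw [map_sum, Finset.mul_sum]
    refine Finset.sum_congr rfl fun i _ => ?_
    rw [map_smul, smul_eq_mul]
    ring
  have h2 : ∀ x, inner ℝ v (G x) * φ x = ∑ i, v i * (G x i * φ x) := by
    intro x
    rw [PiLp.inner_apply, Finset.sum_mul]
    refine Finset.sum_congr rfl fun i _ => ?_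
    simp only [RCLike.inner_apply, conj_trivial]
    ring
  simp_rw [h1, h2]
  rw [integral_finsetSum, integral_finsetSum, ← Finset.sum_neg_distrib]
  · refine Finset.sum_congr rfl fun i _ => ?_
    rw [integral_const_mul, integral_const_mul, hG φ hφ hc i, mul_neg]
  · exact fun i _ => (integrable_mul_test (memLp_coord G i) hφ.continuous hc).const_mul _
  · exact fun i _ => (integrable_mul_test (Lp.memLp u) (continuous_partial hφ _)
      (hasCompactSupport_partial hc _)).const_mul _

theorem abs_integral_inner_mul_le (G : L2Vec N) (v : E N) {ψ : E N → ℝ}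
    (hψ : MemLp ψ 2 volume) :
    |∫ x, inner ℝ v (G x) * ψ x| ≤ ‖v‖ * ‖G‖ * (eLpNorm ψ 2 volume).toReal := by
  have hL : MemLp (fun x => inner ℝ v (G x)) 2 volume :=
    (innerSL ℝ v).comp_memLp' (Lp.memLp G)
  have hn : ‖hL.toLp‖ ≤ ‖v‖ * ‖G‖ := by
    refine Lp.norm_le_mul_norm_of_ae_le_mul ?_
    filter_upwards [hL.coeFn_toLp] with x hx
    rw [hx]
    exact norm_inner_le_norm v (G x)
  have hi : inner ℝ (hψ.toLp) (hL.toLp) = ∫ x, inner ℝ v (G x) * ψ x := by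
    rw [L2.inner_def]
    refine integral_congr_ae ?_
    filter_upwards [hL.coeFn_toLp, hψ.coeFn_toLp] with x h1 h2
    rw [h1, h2]
    simp
  rw [← hi, ← Lp.norm_toLp ψ hψ, mul_comm]
  refine (abs_real_inner_le_norm _ _).trans ?_
  gcongr

/-- The convolution `g = u ⋆ φ` is differentiable, and testing the weak gradient with `x ↦ φ (y -
x)` gives its derivative along `v` as `∫ ⟨v, G x⟩ φ (y - x) dx`. By Cauchy–Schwarz this is bounded
uniformly in `y`, and the mean value inequality on the segment from `0` to `v` concludes. -/
theorem IsWeakGradient.abs_convolution_sub_le {u : L2 N} {G : L2Vec N} (hG : IsWeakGradient u G)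
    {φ : E N → ℝ} (hφ : ContDiff ℝ ∞ φ) (hc : HasCompactSupport φ) (v : E N) :
    |(∫ x, u x * φ (v - x)) - ∫ x, u x * φ (-x)|
      ≤ ‖v‖ * ‖G‖ * (eLpNorm φ 2 volume).toReal := by
  set g : E N → ℝ := (fun x => u x) ⋆[ContinuousLinearMap.mul ℝ ℝ, volume] φ with hg
  have hgy : ∀ y, g y = ∫ x, u x * φ (y - x) := fun y => rfl
  have hloc : LocallyIntegrable (fun x => u x) (volume : Measure (E N)) :=
    (Lp.memLp u).locallyIntegrable (by norm_num)
  have hd : ∀ y, HasFDerivAt g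
      (((fun x => u x) ⋆[(ContinuousLinearMap.mul ℝ ℝ).precompR (E N), volume] fderiv ℝ φ) y) y :=
    fun y => hc.hasFDerivAt_convolution_right _ hloc (hφ.of_le (by simp)) y
  have hdv : ∀ y, ((fun x => u x) ⋆[(ContinuousLinearMap.mul ℝ ℝ).precompR (E N), volume]
      fderiv ℝ φ) y v = ∫ x, inner ℝ v (G x) * φ (y - x) := by
    intro y
    rw [convolution_precompR_apply _ hloc (hc.fderiv ℝ) (hφ.continuous_fderiv (by simp))]
    have hψ : ContDiff ℝ ∞ (fun x => φ (y - x)) := hφ.comp (contDiff_const.sub contDiff_id)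
    have hψc : HasCompactSupport (fun x => φ (y - x)) :=
      hc.comp_homeomorph (Homeomorph.subLeft y)
    have := hG.integral_fderiv hψ hψc v
    have hf : ∀ x, fderiv ℝ (fun x => φ (y - x)) x v = - fderiv ℝ φ (y - x) v := by
      intro x
      have h := ((hφ.differentiable (by simp)) (y - x)).hasFDerivAt.comp x
        ((hasFDerivAt_const y x).sub (hasFDerivAt_id x))
      have h' : fderiv ℝ (fun x => φ (y - x)) x = _ := h.fderiv
      simp [h']
    simp only [hf, mul_neg, integral_neg, neg_inj] at this
    exact this
  have hmem : ∀ y, MemLp (fun x => φ (y - x)) 2 volume ∧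
      eLpNorm (fun x => φ (y - x)) 2 volume = eLpNorm φ 2 volume := by
    intro y
    have hp := Measure.measurePreserving_sub_left (volume : Measure (E N)) y
    have hm : MemLp φ 2 (volume : Measure (E N)) := hφ.continuous.memLp_of_hasCompactSupport hc
    exact ⟨hm.comp_measurePreserving hp,
      eLpNorm_comp_measurePreserving hm.aestronglyMeasurable hp⟩
  have hline : ∀ t : ℝ, HasDerivAt (fun t : ℝ => g (t • v))
      (∫ x, inner ℝ v (G x) * φ (t • v - x)) t := by
    intro t
    have h := (hd (t • v)).comp_hasDerivAt t ((hasDerivAt_id t).smul_const v)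
    rw [one_smul, hdv] at h
    exact h
  have hmv := norm_image_sub_le_of_norm_deriv_le_segment_01'
    (fun t _ => (hline t).hasDerivWithinAt) (C := ‖v‖ * ‖G‖ * (eLpNorm φ 2 volume).toReal)
    (fun t _ => by
      rw [Real.norm_eq_abs, ← (hmem (t • v)).2]
      exact abs_integral_inner_mul_le G v (hmem (t • v)).1)
  simpa [hgy] using hmv

theorem coeFn_translate_sub (u : L2 N) (v : E N) :
    ∀ᵐ x, (Lp.compMeasurePreserving (· + v) (measurePreserving_add_right volume v) u - u : L2 N) x
      = u (x + v) - u x := by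
  filter_upwards [Lp.coeFn_sub (Lp.compMeasurePreserving (· + v)
    (measurePreserving_add_right volume v) u) u,
    Lp.coeFn_compMeasurePreserving u (measurePreserving_add_right volume v)] with x h1 h2
  rw [h1, Pi.sub_apply, h2]
  rfl

/-- By duality: pairing with a test function moves the translation onto it, so no approximation of
`u` by smooth functions is needed. Density extends the bound to every `f` in `L²`. -/
theorem IsWeakGradient.norm_translate_sub_le {u : L2 N} {G : L2Vec N} (hG : IsWeakGradient u G)
    (v : E N) :
    ‖Lp.compMeasurePreserving (· + v) (measurePreserving_add_right volume v) u - u‖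
      ≤ ‖v‖ * ‖G‖ := by
  set w : L2 N := Lp.compMeasurePreserving (· + v) (measurePreserving_add_right volume v) u - u
  have hwx : ∀ᵐ x, w x = u (x + v) - u x := coeFn_translate_sub u v
  have key : ∀ f : L2 N, |inner ℝ f w| ≤ ‖v‖ * ‖G‖ * ‖f‖ := by
    intro f
    have hcl : IsClosed {f : L2 N | |inner ℝ f w| ≤ ‖v‖ * ‖G‖ * ‖f‖} :=
      isClosed_le (by fun_prop) (by fun_prop)
    refine (Lp.dense_hasCompactSupport_contDiff (F := ℝ) (p := 2) (by norm_num)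
      (μ := (volume : Measure (E N)))).induction ?_ hcl f
    rintro f ⟨φ, hfφ, hc, hφ⟩
    have hm : MemLp φ 2 (volume : Measure (E N)) := hφ.continuous.memLp_of_hasCompactSupport hc
    -- The reflection undoes the one in the convolution, which evaluates its kernel at `v - x`.
    have hφ' : ContDiff ℝ ∞ (fun x => φ (-x)) := hφ.comp contDiff_neg
    have hc' : HasCompactSupport (fun x => φ (-x)) := hc.comp_homeomorph (Homeomorph.neg _)
    have hn : eLpNorm (fun x => φ (-x)) 2 (volume : Measure (E N)) = eLpNorm φ 2 volume :=
      eLpNorm_comp_measurePreserving hm.aestronglyMeasurable (Measure.measurePreserving_neg volume)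
    have hnf : ‖f‖ = (eLpNorm φ 2 volume).toReal := by
      rw [Lp.norm_def, eLpNorm_congr_ae hfφ]
    have h1 : Integrable (fun x => u x * φ (x - v)) :=
      integrable_mul_test (Lp.memLp u) (hφ.continuous.comp (continuous_id.sub continuous_const))
        (hc.comp_homeomorph (Homeomorph.subRight v))
    have h1' : Integrable (fun x => u (x + v) * φ x) := by
      simpa using h1.comp_add_right v
    have hi : inner ℝ f w = (∫ x, u x * φ (x - v)) - ∫ x, u x * φ x := by
      have h2 : ∫ x, u (x + v) * φ x = ∫ x, u x * φ (x - v) := by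
        simpa using integral_add_right_eq_self (fun x => u x * φ (x - v)) v
      rw [← h2, ← integral_sub h1' (integrable_mul_test (Lp.memLp u) hφ.continuous hc),
        L2.inner_def]
      refine integral_congr_ae ?_
      filter_upwards [hwx, hfφ] with x hx hx'
      rw [hx, hx']
      simp only [RCLike.inner_apply, conj_trivial]
      ring
    have := hG.abs_convolution_sub_le hφ' hc' v
    simp only [neg_sub, neg_neg] at this
    rw [hi, hnf, ← hn]
    exact this
  -- With `f = w` this reads `‖w‖² ≤ ‖v‖ ‖G‖ ‖w‖`.
  have := key w
  rw [real_inner_self_eq_norm_sq, abs_of_nonneg (by positivity)] at this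
  by_contra! hlt
  have h0 : 0 < ‖w‖ := lt_of_le_of_lt (by positivity) hlt
  nlinarith

theorem lintegral_translate_sub_eq (u : L2 N) (v : E N) :
    ∫⁻ x, ‖u (x + v) - u x‖ₑ ^ (2 : ℝ) =
      ‖Lp.compMeasurePreserving (· + v) (measurePreserving_add_right volume v) u - u‖ₑ
        ^ (2 : ℝ) := by
  rw [enorm_lp_rpow_two]
  refine lintegral_congr_ae ?_
  filter_upwards [coeFn_translate_sub u v] with x hx
  rw [hx]

theorem lintegral_translate_sub_le_norm (u : L2 N) (v : E N) :
    ∫⁻ x, ‖u (x + v) - u x‖ₑ ^ (2 : ℝ) ≤ 4 * ‖u‖ₑ ^ (2 : ℝ) := by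
  have h : ‖Lp.compMeasurePreserving (· + v) (measurePreserving_add_right volume v) u - u‖ₑ
      ≤ 2 * ‖u‖ₑ := by
    refine (enorm_sub_le).trans (le_of_eq ?_)
    rw [two_mul, ← ofReal_norm (Lp.compMeasurePreserving _ _ u), Lp.norm_compMeasurePreserving,
      ofReal_norm]
  rw [lintegral_translate_sub_eq]
  refine (ENNReal.rpow_le_rpow h (by norm_num)).trans (le_of_eq ?_)
  rw [ENNReal.mul_rpow_of_nonneg _ _ (by norm_num)]
  norm_num

/-- Translation estimate: `‖u(· + v) - u‖₂ ≤ ‖v‖ ‖∇u‖₂`. -/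
theorem IsWeakGradient.lintegral_translate_sub_le {u : L2 N} {G : L2Vec N}
    (hG : IsWeakGradient u G) (v : E N) :
    ∫⁻ x, ‖u (x + v) - u x‖ₑ ^ (2 : ℝ) ≤ ‖v‖ₑ ^ (2 : ℝ) * ‖G‖ₑ ^ (2 : ℝ) := by
  rw [lintegral_translate_sub_eq, ← ENNReal.mul_rpow_of_nonneg _ _ (by norm_num)]
  gcongr
  rw [← ofReal_norm, ← ofReal_norm, ← ofReal_norm, ← ENNReal.ofReal_mul (norm_nonneg _)]
  exact ENNReal.ofReal_le_ofReal (hG.norm_translate_sub_le v)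

end Translation

/-! ### Poincaré's inequality by translating `Ω` off itself. -/

section Poincare

variable {N : ℕ} {Ω : Set (E N)}

theorem exists_norm_eq_real (hN : 1 ≤ N) {R : ℝ} (hR : 0 ≤ R) : ∃ v : E N, ‖v‖ = R :=
  ⟨EuclideanSpace.single ⟨0, hN⟩ R, by simp [abs_of_nonneg hR]⟩

/-- A translation that moves the support off itself does not cancel. -/
theorem enorm_rpow_two_le_lintegral_translate {R : ℝ} (hR : Ω ⊆ Metric.closedBall 0 R)
    {u : L2 N} (hu : u ∈ vanishingOutside Ω) {v : E N} (hv : 2 * R < ‖v‖) :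
    ‖u‖ₑ ^ (2 : ℝ) ≤ ∫⁻ x, ‖u (x + v) - u x‖ₑ ^ (2 : ℝ) := by
  have hu' : ∀ᵐ x, x + v ∉ Ω → u (x + v) = 0 :=
    (measurePreserving_add_right volume v).quasiMeasurePreserving.ae hu
  rw [enorm_lp_rpow_two]
  refine lintegral_mono_ae ?_
  filter_upwards [hu, hu'] with x h1 h2
  by_cases hx : x ∈ Ω
  · have hxv : x + v ∉ Ω := by
      intro hmem
      have a := hR hx
      have b := hR hmem
      rw [mem_closedBall_zero_iff] at a b
      have : ‖v‖ ≤ ‖x + v‖ + ‖x‖ := by simpa using norm_sub_le (x + v) x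
      linarith
    rw [h2 hxv, zero_sub, enorm_neg]
  · simp [h1 hx]

/-- Poincaré inequality for functions vanishing outside a bounded set. -/
theorem exists_norm_le_mul_norm_grad (hN : 1 ≤ N) (hbdd : Bornology.IsBounded Ω) :
    ∃ C : ℝ, 0 ≤ C ∧ ∀ u ∈ vanishingOutside Ω, ∀ G : L2Vec N, IsWeakGradient u G →
      ‖u‖ ≤ C * ‖G‖ := by
  obtain ⟨R, hR0, hR⟩ := hbdd.subset_closedBall_lt 0 0
  -- Any length above the diameter bound `2 * R` would do.
  obtain ⟨v, hv⟩ := exists_norm_eq_real hN (R := 3 * R) (by positivity)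
  refine ⟨‖v‖, norm_nonneg v, fun u hu G hG => ?_⟩
  have h : ‖u‖ₑ ^ (2 : ℝ) ≤ (‖v‖ₑ * ‖G‖ₑ) ^ (2 : ℝ) := by
    rw [ENNReal.mul_rpow_of_nonneg _ _ (by norm_num)]
    exact (enorm_rpow_two_le_lintegral_translate hR hu (by linarith)).trans
      (hG.lintegral_translate_sub_le v)
  have h' := (ENNReal.rpow_le_rpow_iff (by norm_num)).1 h
  rw [← ofReal_norm, ← ofReal_norm, ← ofReal_norm, ← ENNReal.ofReal_mul (norm_nonneg _)] at h'
  exact (ENNReal.ofReal_le_ofReal_iff (by positivity)).1 h'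

end Poincare

/-! ### The singular kernel and the near/far splitting of the seminorm. -/

section Kernel

variable {N : ℕ}

/-- In polar coordinates the radial integrand is `y^(N-1) y^(2-N-2s) = y^(1-2s)`, integrable at `0`
because `s < 1`. -/
theorem setLIntegral_ball_kernel_lt_top (hN : 1 ≤ N) {s : ℝ} (hs : s < 1) :
    ∫⁻ h : E N in Metric.ball 0 1, ‖h‖ₑ ^ (2 : ℝ) / ‖h‖ₑ ^ ((N : ℝ) + 2 * s) < ⊤ := by
  have : Nontrivial (E N) := by
    have : Nonempty (Fin N) := ⟨⟨0, hN⟩⟩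
    infer_instance
  have hi : IntegrableOn (fun h : E N => ‖h‖ ^ (2 - ((N : ℝ) + 2 * s))) (Metric.ball 0 1)
      volume := by
    rw [integrableOn_fun_norm_addHaar volume (f := fun y => y ^ (2 - ((N : ℝ) + 2 * s)))]
    have h1 : IntegrableOn (fun y : ℝ => y ^ (1 - 2 * s)) (Set.Ioo 0 1) :=
      (intervalIntegral.integrableOn_Ioo_rpow_iff one_pos).2 (by linarith)
    refine h1.congr_fun (fun y hy => ?_) measurableSet_Ioo
    simp only [finrank_euclideanSpace, Fintype.card_fin, smul_eq_mul]
    rw [← Real.rpow_natCast, ← Real.rpow_add hy.1, Nat.cast_sub hN]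
    congr 1
    push_cast
    ring
  refine lt_of_le_of_lt (lintegral_mono fun h => ?_) hi.setLIntegral_lt_top
  -- At `h = 0` the left side is `0`, since `0 / a = 0` in `ℝ≥0∞` for every `a`.
  rcases eq_or_ne h 0 with rfl | h0
  · simp
  · have hp : 0 < ‖h‖ := norm_pos_iff.2 h0
    rw [Real.rpow_sub hp, ENNReal.ofReal_div_of_pos (by positivity),
      ← ENNReal.ofReal_rpow_of_pos hp, ← ENNReal.ofReal_rpow_of_pos hp, ofReal_norm]

/-- For `‖h‖ ≥ r` one has `1 + ‖h‖ ≤ (1 + r⁻¹) ‖h‖`, so a multiple of `(1 + ‖h‖)^(-(N+2s))`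
dominates the kernel; it is integrable because `N + 2s > N`. -/
theorem setLIntegral_compl_ball_kernel_lt_top {s : ℝ} (hs : 0 < s) {r : ℝ} (hr : 0 < r) :
    ∫⁻ h : E N in (Metric.ball 0 r)ᶜ, (‖h‖ₑ ^ ((N : ℝ) + 2 * s))⁻¹ < ⊤ := by
  have ha : 0 < (N : ℝ) + 2 * s := by positivity
  set C : ℝ := (1 + r⁻¹) ^ ((N : ℝ) + 2 * s)
  have hi : Integrable (fun h : E N => C * (1 + ‖h‖) ^ (-((N : ℝ) + 2 * s))) volume :=
    (integrable_one_add_norm (by simpa using hs)).const_mul C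
  refine lt_of_le_of_lt ?_ hi.lintegral_lt_top
  refine (setLIntegral_mono' (Metric.isOpen_ball.measurableSet.compl) (fun h hh => ?_)).trans
    (setLIntegral_le_lintegral _ _)
  have hrh : r ≤ ‖h‖ := by simpa using hh
  have hp : 0 < ‖h‖ := hr.trans_le hrh
  rw [← ofReal_norm, ENNReal.ofReal_rpow_of_pos hp, ← ENNReal.ofReal_inv_of_pos (by positivity)]
  refine ENNReal.ofReal_le_ofReal ?_
  rw [Real.rpow_neg (by positivity), ← div_eq_mul_inv, ← Real.div_rpow (by positivity)
    (by positivity), ← Real.inv_rpow hp.le]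
  gcongr
  rw [inv_eq_one_div, div_le_div_iff₀ hp (by positivity)]
  have : 1 ≤ r⁻¹ * ‖h‖ := by
    rw [inv_mul_eq_div, one_le_div hr]
    exact hrh
  linarith

theorem lintegral_prod_eq_lintegral_translate {F : E N × E N → ℝ≥0∞} (hF : Measurable F) :
    ∫⁻ p, F p = ∫⁻ h, ∫⁻ x, F (x + h, x) := by
  rw [Measure.volume_eq_prod, lintegral_prod_symm' F hF]
  have : ∀ y : E N, ∫⁻ x, F (x, y) = ∫⁻ h, F (y + h, y) := fun y =>
    (lintegral_add_left_eq_self (fun x => F (x, y)) y).symm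
  simp_rw [this]
  exact lintegral_lintegral_swap (by fun_prop)

theorem gagliardo_rpow_two (s : ℝ) (u : L2 N) :
    gagliardo s u ^ (2 : ℝ) =
      ∫⁻ h, (∫⁻ x, ‖u (x + h) - u x‖ₑ ^ (2 : ℝ)) * (‖h‖ₑ ^ ((N : ℝ) + 2 * s))⁻¹ := by
  have hu : Measurable u := (Lp.stronglyMeasurable u).measurable
  rw [gagliardo, ← ENNReal.rpow_mul]
  norm_num only
  rw [ENNReal.rpow_one, lintegral_prod_eq_lintegral_translate (by fun_prop)]
  refine lintegral_congr fun h => ?_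
  simp only [add_sub_cancel_left, div_eq_mul_inv]
  exact lintegral_mul_const _ (by fun_prop)

/-- Splitting the Gagliardo seminorm into short and long range interactions. -/
theorem IsWeakGradient.gagliardo_rpow_two_le (s : ℝ) {u : L2 N} {G : L2Vec N}
    (hG : IsWeakGradient u G) (r : ℝ) :
    gagliardo s u ^ (2 : ℝ) ≤
      (∫⁻ h : E N in Metric.ball 0 r, ‖h‖ₑ ^ (2 : ℝ) / ‖h‖ₑ ^ ((N : ℝ) + 2 * s)) * ‖G‖ₑ ^ (2 : ℝ)
      + (∫⁻ h : E N in (Metric.ball 0 r)ᶜ, (‖h‖ₑ ^ ((N : ℝ) + 2 * s))⁻¹) *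
        (4 * ‖u‖ₑ ^ (2 : ℝ)) := by
  rw [gagliardo_rpow_two, ← lintegral_add_compl _ (Metric.isOpen_ball (x := (0 : E N))
    (ε := r)).measurableSet, ← lintegral_mul_const _ (by fun_prop),
    ← lintegral_mul_const _ (by fun_prop)]
  refine add_le_add (lintegral_mono fun h => ?_) (lintegral_mono fun h => ?_)
  · calc _ ≤ ‖h‖ₑ ^ (2 : ℝ) * ‖G‖ₑ ^ (2 : ℝ) * (‖h‖ₑ ^ ((N : ℝ) + 2 * s))⁻¹ := by
          gcongr
          exact hG.lintegral_translate_sub_le h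
      _ = _ := by
          rw [div_eq_mul_inv]
          ring
  · dsimp only
    rw [mul_comm]
    gcongr
    exact lintegral_translate_sub_le_norm u h

/-- Absolute continuity of the integral: the kernel is integrable on the unit ball and the volume of
the ball of radius `r` tends to `0`. -/
theorem tendsto_setLIntegral_ball_kernel (hN : 1 ≤ N) {s : ℝ} (hs : s < 1) :
    Tendsto (fun r : ℝ => ∫⁻ h : E N in Metric.ball 0 r,
      ‖h‖ₑ ^ (2 : ℝ) / ‖h‖ₑ ^ ((N : ℝ) + 2 * s)) (𝓝[>] 0) (𝓝 0) := by
  have : Nontrivial (E N) := by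
    have : Nonempty (Fin N) := ⟨⟨0, hN⟩⟩
    infer_instance
  have hvol : Tendsto (fun r : ℝ => volume (Metric.ball (0 : E N) r)) (𝓝[>] 0) (𝓝 0) := by
    have h1 : Tendsto (fun r : ℝ => ENNReal.ofReal (r ^ N) * volume (Metric.ball (0 : E N) 1))
        (𝓝[>] 0) (𝓝 0) := by
      have h2 : Tendsto (fun r : ℝ => ENNReal.ofReal (r ^ N)) (𝓝[>] 0) (𝓝 0) := by
        have : Continuous (fun r : ℝ => ENNReal.ofReal (r ^ N)) :=
          ENNReal.continuous_ofReal.comp (continuous_pow N)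
        simpa [Nat.one_le_iff_ne_zero.1 hN] using (this.tendsto 0).mono_left nhdsWithin_le_nhds
      simpa using ENNReal.Tendsto.mul_const h2 (Or.inr measure_ball_lt_top.ne)
    refine h1.congr' ?_
    filter_upwards [self_mem_nhdsWithin] with r hr
    rw [Measure.addHaar_ball volume (0 : E N) (le_of_lt hr)]
    simp
  have h := tendsto_setLIntegral_zero (μ := volume.restrict (Metric.ball (0 : E N) 1))
    (setLIntegral_ball_kernel_lt_top hN hs).ne (l := 𝓝[>] (0 : ℝ))
    (s := fun r => Metric.ball (0 : E N) r) ?_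
  · refine h.congr' ?_
    filter_upwards [Ioo_mem_nhdsGT (zero_lt_one' ℝ)] with r hr
    rw [Measure.restrict_restrict Metric.isOpen_ball.measurableSet,
      Set.inter_eq_left.2 (Metric.ball_subset_ball hr.2.le)]
  · exact tendsto_of_tendsto_of_tendsto_of_le_of_le tendsto_const_nhds hvol
      (fun _ => zero_le) (fun r => Measure.restrict_apply_le _ _)

end Kernel

/-! ### Approximation by averages over a grid of cubes. -/

section Cells

variable {N : ℕ}

/-- The index of the cube of side `ε` that contains `x`. -/
def cellIndex (ε : ℝ) (x : E N) : Fin N → ℤ := fun i => ⌊x i / ε⌋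

/-- The half-open cubes of side `ε` with vertices in `ε ℤ^N`. -/
def cell (ε : ℝ) (k : Fin N → ℤ) : Set (E N) := {x | cellIndex ε x = k}

theorem measurableSet_cell (ε : ℝ) (k : Fin N → ℤ) : MeasurableSet (cell ε k) := by
  have h : Measurable (cellIndex ε : E N → Fin N → ℤ) := by
    refine measurable_pi_lambda _ fun i => Int.measurable_floor.comp ?_
    fun_prop
  exact h (measurableSet_singleton k)

theorem volume_cell {ε : ℝ} (hε : 0 < ε) (k : Fin N → ℤ) :
    volume (cell ε k) = ENNReal.ofReal (ε ^ N) := by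
  have h : cell ε k = WithLp.ofLp ⁻¹'
      (Set.univ.pi fun i => Set.Ico ((k i : ℝ) * ε) (((k i : ℝ) + 1) * ε)) := by
    ext x
    simp only [cell, cellIndex, Set.mem_ofPred_eq, funext_iff, Int.floor_eq_iff, Set.mem_preimage,
      Set.mem_univ_pi, Set.mem_Ico, le_div_iff₀ hε, div_lt_iff₀ hε]
  rw [h, (PiLp.volume_preserving_ofLp (Fin N)).measure_preimage
    (MeasurableSet.univ_pi fun i => measurableSet_Ico).nullMeasurableSet, Real.volume_pi_Ico]
  simp [add_mul, ENNReal.ofReal_pow hε.le]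

theorem norm_sub_le_of_cellIndex_eq {ε : ℝ} (hε : 0 < ε) {x y : E N}
    (h : cellIndex ε x = cellIndex ε y) : ‖x - y‖ ≤ N * ε := by
  have hi : ∀ i, ‖(x - y) i‖ ≤ ε := by
    intro i
    have h1 := Int.abs_sub_lt_one_of_floor_eq_floor (congrFun h i)
    rw [← sub_div, abs_div, abs_of_pos hε, div_lt_one hε] at h1
    simpa using h1.le
  rw [EuclideanSpace.norm_eq]
  refine Real.sqrt_le_iff.2 ⟨by positivity, ?_⟩
  calc ∑ i, ‖(x - y) i‖ ^ 2 ≤ ∑ _i : Fin N, ε ^ 2 := by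
        gcongr with i
        exact hi i
    _ = N * ε ^ 2 := by simp
    -- The sharp factor `√N` is relaxed to `N`.
    _ ≤ (N : ℝ) ^ 2 * ε ^ 2 := by
        gcongr
        exact_mod_cast Nat.le_self_pow (by norm_num) N
    _ = (N * ε) ^ 2 := by ring

theorem finite_image_cellIndex {ε : ℝ} (hε : 0 < ε) {Ω : Set (E N)}
    (hbdd : Bornology.IsBounded Ω) : (cellIndex ε '' Ω).Finite := by
  obtain ⟨R, hR⟩ := hbdd.subset_closedBall 0
  refine (Set.finite_Icc (fun _ : Fin N => ⌊-R / ε⌋) (fun _ => ⌊R / ε⌋)).subset ?_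
  rintro _ ⟨x, hx, rfl⟩
  have hx' : ‖x‖ ≤ R := by simpa using hR hx
  have hi : ∀ i, |x i| ≤ R := fun i => (PiLp.norm_apply_le x i).trans hx'
  constructor <;> intro i <;> refine Int.floor_le_floor (div_le_div_of_nonneg_right ?_ hε.le)
  · exact (abs_le.1 (hi i)).1
  · exact (abs_le.1 (hi i)).2

/-- Jensen's inequality for the normalized measure on `Q`, in the form `L¹ norm ≤ L² norm`. -/
theorem enorm_sub_average_rpow_two_le {α : Type*} [MeasurableSpace α] {μ : Measure α} {Q : Set α}
    (h0 : μ Q ≠ 0) (ht : μ Q ≠ ⊤) {f : α → ℝ} (hf : MemLp f 2 μ) (c : ℝ) :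
    ‖c - ⨍ y in Q, f y ∂μ‖ₑ ^ (2 : ℝ) ≤ (μ Q)⁻¹ * ∫⁻ y in Q, ‖f y - c‖ₑ ^ (2 : ℝ) ∂μ := by
  set ν : Measure α := (μ Q)⁻¹ • μ.restrict Q with hν
  have hprob : IsProbabilityMeasure ν := ⟨by
    rw [hν, Measure.smul_apply, Measure.restrict_apply_univ, smul_eq_mul,
      ENNReal.inv_mul_cancel h0 ht]⟩
  have hfν : MemLp f 2 ν := (hf.restrict Q).smul_measure (ENNReal.inv_ne_top.2 h0)
  have hcν : MemLp (fun y => f y - c) 2 ν := hfν.sub (memLp_const c)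
  have h1 : c - ⨍ y in Q, f y ∂μ = -∫ y, (f y - c) ∂ν := by
    rw [average_eq', Measure.restrict_apply_univ,
      integral_sub (hfν.integrable (by norm_num)) (integrable_const c)]
    simp [hν]
  calc ‖c - ⨍ y in Q, f y ∂μ‖ₑ ^ (2 : ℝ) ≤ (eLpNorm (fun y => f y - c) 2 ν) ^ (2 : ℝ) := by
        gcongr
        rw [h1, enorm_neg]
        refine (enorm_integral_le_lintegral_enorm _).trans ?_
        rw [← eLpNorm_one_eq_lintegral_enorm]
        exact eLpNorm_le_eLpNorm_of_exponent_le (by norm_num) hcν.aestronglyMeasurable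
    _ = ∫⁻ y, ‖f y - c‖ₑ ^ (2 : ℝ) ∂ν := by
        rw [eLpNorm_eq_lintegral_rpow_enorm_toReal (by norm_num) (by norm_num), ← ENNReal.rpow_mul]
        simp
    _ = _ := by rw [hν, lintegral_smul_measure, smul_eq_mul]

/-- The constant in the estimate for the approximation by averages over cells. -/
def cellConst (N : ℕ) : ℝ≥0∞ :=
  ENNReal.ofReal (((N : ℝ) + 1) ^ N) * volume (Metric.ball (0 : E N) 1)
    * ENNReal.ofReal ((N : ℝ) + 1) ^ (2 : ℝ)

theorem cellConst_ne_top : cellConst N ≠ ⊤ := by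
  refine ENNReal.mul_ne_top (ENNReal.mul_ne_top ENNReal.ofReal_ne_top measure_ball_lt_top.ne) ?_
  exact ENNReal.rpow_ne_top_of_nonneg (by norm_num) ENNReal.ofReal_ne_top

/-- Approximation of a function by its averages over the cells of side `ε`. -/
theorem IsWeakGradient.lintegral_sub_cell_average_le (hN : 1 ≤ N) {u : L2 N} {G : L2Vec N}
    (hG : IsWeakGradient u G) {ε : ℝ} (hε : 0 < ε) :
    ∫⁻ x, ‖u x - ⨍ y in cell ε (cellIndex ε x), u y‖ₑ ^ (2 : ℝ)
      ≤ cellConst N * ENNReal.ofReal ε ^ (2 : ℝ) * ‖G‖ₑ ^ (2 : ℝ) := by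
  have hu : Measurable u := (Lp.stronglyMeasurable u).measurable
  have hm0 : ENNReal.ofReal (ε ^ N) ≠ 0 := by simp [hε]
  -- The cell of `x` has diameter at most `N * ε`, so it lies in the open ball of radius `R` around
  -- `x`; the extra `ε` gives strictness.
  set R : ℝ := ((N : ℝ) + 1) * ε with hR
  have hR0 : 0 < R := by positivity
  -- Enlarging the cell to a ball makes the domain in `h` independent of `x`, so that Tonelli
  -- applies and the translation estimate can be used for each `h`. The volume of the ball then
  -- absorbs the factor `ε^(-N)`.
  have hpt : ∀ x, ‖u x - ⨍ y in cell ε (cellIndex ε x), u y‖ₑ ^ (2 : ℝ)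
      ≤ (ENNReal.ofReal (ε ^ N))⁻¹ *
        ∫⁻ h in Metric.ball 0 R, ‖u (x + h) - u x‖ₑ ^ (2 : ℝ) := by
    intro x
    have h1 := enorm_sub_average_rpow_two_le (μ := volume) (Q := cell ε (cellIndex ε x))
      (by rw [volume_cell hε]; exact hm0) (by rw [volume_cell hε]; exact ENNReal.ofReal_ne_top)
      (Lp.memLp u) (u x)
    rw [volume_cell hε] at h1
    refine h1.trans (mul_le_mul_right ?_ _)
    rw [← lintegral_indicator (measurableSet_cell _ _),
      ← lintegral_indicator Metric.isOpen_ball.measurableSet,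
      ← lintegral_add_left_eq_self _ x]
    refine lintegral_mono fun h => ?_
    by_cases hc : x + h ∈ cell ε (cellIndex ε x)
    · have hb : h ∈ Metric.ball (0 : E N) R := by
        rw [mem_ball_zero_iff]
        have := norm_sub_le_of_cellIndex_eq hε hc
        rw [add_sub_cancel_left] at this
        refine this.trans_lt ?_
        rw [hR]
        nlinarith
      rw [Set.indicator_of_mem hc, Set.indicator_of_mem hb]
    · rw [Set.indicator_of_notMem hc]
      exact zero_le
  calc ∫⁻ x, ‖u x - ⨍ y in cell ε (cellIndex ε x), u y‖ₑ ^ (2 : ℝ)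
      ≤ ∫⁻ x, (ENNReal.ofReal (ε ^ N))⁻¹ *
        ∫⁻ h in Metric.ball 0 R, ‖u (x + h) - u x‖ₑ ^ (2 : ℝ) := lintegral_mono hpt
    _ = (ENNReal.ofReal (ε ^ N))⁻¹ *
        ∫⁻ h in Metric.ball 0 R, ∫⁻ x, ‖u (x + h) - u x‖ₑ ^ (2 : ℝ) := by
        rw [lintegral_const_mul' _ _ (ENNReal.inv_ne_top.2 hm0), lintegral_lintegral_swap]
        fun_prop
    _ ≤ (ENNReal.ofReal (ε ^ N))⁻¹ *
        ∫⁻ h in Metric.ball (0 : E N) R, ENNReal.ofReal R ^ (2 : ℝ) * ‖G‖ₑ ^ (2 : ℝ) := by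
        refine mul_le_mul_right ?_ _
        refine setLIntegral_mono' Metric.isOpen_ball.measurableSet fun h hh => ?_
        refine (hG.lintegral_translate_sub_le h).trans ?_
        gcongr
        rw [← ofReal_norm]
        exact ENNReal.ofReal_le_ofReal (mem_ball_zero_iff.1 hh).le
    _ = _ := by
        have : Nonempty (Fin N) := ⟨⟨0, hN⟩⟩
        rw [setLIntegral_const, Measure.addHaar_ball volume (0 : E N) hR0.le, cellConst,
          finrank_euclideanSpace, Fintype.card_fin, hR, mul_pow,
          ENNReal.ofReal_mul (by positivity), ENNReal.ofReal_mul (by positivity),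
          ENNReal.mul_rpow_of_nonneg _ _ (by norm_num : (0 : ℝ) ≤ 2)]
        calc _ = ((ENNReal.ofReal (ε ^ N))⁻¹ * ENNReal.ofReal (ε ^ N)) *
              (ENNReal.ofReal (((N : ℝ) + 1) ^ N) * volume (Metric.ball (0 : E N) 1)
              * ENNReal.ofReal ((N : ℝ) + 1) ^ (2 : ℝ) * ENNReal.ofReal ε ^ (2 : ℝ)
              * ‖G‖ₑ ^ (2 : ℝ)) := by ring
          _ = _ := by rw [ENNReal.inv_mul_cancel hm0 ENNReal.ofReal_ne_top, one_mul]

end Cells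

/-! ### Total boundedness in `L²`. -/

section Rellich

variable {N : ℕ} {Ω : Set (E N)}

/-- The indicator function of a cell as an element of `L²`. -/
def cellIndicator {ε : ℝ} (hε : 0 < ε) (k : Fin N → ℤ) : L2 N :=
  indicatorConstLp 2 (measurableSet_cell ε k)
    (by rw [volume_cell hε]; exact ENNReal.ofReal_ne_top) (1 : ℝ)

/-- The set of functions vanishing outside `Ω` with `‖∇u‖₂ ≤ 1`. -/
def gradBall (Ω : Set (E N)) : Set (L2 N) :=
  {u | u ∈ vanishingOutside Ω ∧ ∃ G : L2Vec N, IsWeakGradient u G ∧ ‖G‖ ≤ 1}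

/-- The approximant is the cell average of `u` on the cells in `T` and `0` elsewhere. Dropping the
other cells costs nothing: they miss `Ω`, and `u` vanishes there. -/
theorem exists_mem_span_cellIndicator (hN : 1 ≤ N) {ε : ℝ} (hε : 0 < ε)
    (T : Finset (Fin N → ℤ)) (hT : ∀ x ∈ Ω, cellIndex ε x ∈ T) {u : L2 N} (hu : u ∈ gradBall Ω) :
    ∃ g ∈ Submodule.span ℝ ((cellIndicator hε) '' (T : Set (Fin N → ℤ))),
      ‖u - g‖ₑ ^ (2 : ℝ) ≤ cellConst N * ENNReal.ofReal ε ^ (2 : ℝ) := by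
  obtain ⟨hu, G, hG, hG1⟩ := hu
  refine ⟨∑ k ∈ T, (⨍ y in cell ε k, u y) • cellIndicator hε k,
    Submodule.sum_mem _ fun k hk => Submodule.smul_mem _ _ (Submodule.subset_span ⟨k, hk, rfl⟩), ?_⟩
  set g : L2 N := ∑ k ∈ T, (⨍ y in cell ε k, u y) • cellIndicator hε k with hg
  have hsm : ∀ᵐ x, ∀ k : Fin N → ℤ, ((⨍ y in cell ε k, u y) • cellIndicator hε k : L2 N) x
      = if cellIndex ε x = k then ⨍ y in cell ε k, u y else 0 := by
    refine ae_all_iff.2 fun k => ?_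
    filter_upwards [Lp.coeFn_smul (⨍ y in cell ε k, u y) (cellIndicator hε k),
      indicatorConstLp_coeFn (p := 2) (hs := measurableSet_cell ε k)
        (hμs := by rw [volume_cell hε]; exact ENNReal.ofReal_ne_top) (c := (1 : ℝ))] with x h1 h2
    rw [h1, Pi.smul_apply, cellIndicator, h2]
    by_cases hx : cellIndex ε x = k
    · rw [Set.indicator_of_mem (s := cell ε k) hx, if_pos hx, smul_eq_mul, mul_one]
    · rw [Set.indicator_of_notMem (s := cell ε k) hx, if_neg hx, smul_zero]
  have hgx : ∀ᵐ x, g x = if cellIndex ε x ∈ T then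
      ⨍ y in cell ε (cellIndex ε x), u y else 0 := by
    filter_upwards [hsm, Lp.coeFn_finsetSum T
      (fun k => (⨍ y in cell ε k, u y) • cellIndicator hε k)] with x h1 h2
    rw [hg, h2, Finset.sum_apply]
    simp_rw [h1]
    rw [Finset.sum_ite_eq]
  have hG2 : ‖G‖ₑ ^ (2 : ℝ) ≤ 1 := by
    refine ENNReal.rpow_le_one ?_ (by norm_num)
    rw [← ofReal_norm]
    exact ENNReal.ofReal_le_one.2 hG1
  calc ‖u - g‖ₑ ^ (2 : ℝ) = ∫⁻ x, ‖(u - g : L2 N) x‖ₑ ^ (2 : ℝ) := enorm_lp_rpow_two _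
    _ ≤ ∫⁻ x, ‖u x - ⨍ y in cell ε (cellIndex ε x), u y‖ₑ ^ (2 : ℝ) := by
        refine lintegral_mono_ae ?_
        filter_upwards [hgx, hu, Lp.coeFn_sub u g] with x h1 h2 h3
        rw [h3, Pi.sub_apply, h1]
        split_ifs with hx
        · exact le_rfl
        · rw [h2 fun hxΩ => hx (hT x hxΩ)]
          simp
    _ ≤ cellConst N * ENNReal.ofReal ε ^ (2 : ℝ) * ‖G‖ₑ ^ (2 : ℝ) :=
        hG.lintegral_sub_cell_average_le hN hε
    _ ≤ cellConst N * ENNReal.ofReal ε ^ (2 : ℝ) * 1 := by gcongr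
    _ = _ := mul_one _

/-- The approximants stay in a closed ball of `F`, which is compact; an `ε / 2`-net of that ball is
an `ε`-net of `S`. -/
theorem totallyBounded_of_forall_finiteDimensional {V : Type*} [NormedAddCommGroup V]
    [NormedSpace ℝ V] {S : Set V} (hS : Bornology.IsBounded S)
    (h : ∀ ε > 0, ∃ F : Submodule ℝ V, FiniteDimensional ℝ F ∧ ∀ u ∈ S, ∃ g ∈ F, ‖u - g‖ < ε) :
    TotallyBounded S := by
  obtain ⟨R, hR⟩ := hS.subset_closedBall 0
  refine Metric.totallyBounded_iff.2 fun ε hε => ?_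
  obtain ⟨F, hF, happ⟩ := h (ε / 2) (half_pos hε)
  have hK : TotallyBounded ((Subtype.val : F → V) '' Metric.closedBall 0 (R + ε / 2)) :=
    ((isCompact_closedBall (0 : F) (R + ε / 2)).image continuous_subtype_val).totallyBounded
  obtain ⟨t, ht, hcov⟩ := Metric.totallyBounded_iff.1 hK (ε / 2) (half_pos hε)
  refine ⟨t, ht, fun u hu => ?_⟩
  obtain ⟨g, hgF, hg⟩ := happ u hu
  have hgn : ‖g‖ ≤ R + ε / 2 := by
    have h1 : ‖u‖ ≤ R := by simpa using hR hu
    have h2 : ‖g‖ ≤ ‖u‖ + ‖u - g‖ := by simpa using norm_sub_le u (u - g)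
    linarith
  have hmem := hcov ⟨⟨g, hgF⟩, by simpa using hgn, rfl⟩
  simp only [Set.mem_iUnion] at hmem ⊢
  obtain ⟨y, hy, hgy⟩ := hmem
  refine ⟨y, hy, ?_⟩
  rw [Metric.mem_ball] at hgy ⊢
  calc dist u y ≤ dist u g + dist g y := dist_triangle _ _ _
    _ < ε / 2 + ε / 2 := add_lt_add (by rwa [dist_eq_norm]) hgy
    _ = ε := add_halves ε

/-- Rellich's theorem. -/
theorem totallyBounded_gradBall (hN : 1 ≤ N) (hbdd : Bornology.IsBounded Ω) :
    TotallyBounded (gradBall Ω) := by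
  refine totallyBounded_of_forall_finiteDimensional ?_ fun δ hδ => ?_
  · obtain ⟨C, hC0, hC⟩ := exists_norm_le_mul_norm_grad hN hbdd
    refine (Metric.isBounded_closedBall (x := (0 : L2 N)) (r := C)).subset ?_
    rintro u ⟨hu, G, hG, hG1⟩
    rw [mem_closedBall_zero_iff]
    exact (hC u hu G hG).trans (mul_le_of_le_one_right hC0 hG1)
  · have hlim : Tendsto (fun ε : ℝ => cellConst N * ENNReal.ofReal ε ^ (2 : ℝ)) (𝓝[>] 0) (𝓝 0) := by
      have h1 : Continuous (fun ε : ℝ => ENNReal.ofReal ε ^ (2 : ℝ)) :=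
        ENNReal.continuous_rpow_const.comp ENNReal.continuous_ofReal
      have h2 : Tendsto (fun ε : ℝ => ENNReal.ofReal ε ^ (2 : ℝ)) (𝓝[>] 0) (𝓝 0) := by
        simpa using (h1.tendsto 0).mono_left nhdsWithin_le_nhds
      simpa using ENNReal.Tendsto.const_mul h2 (Or.inr cellConst_ne_top)
    have hpos : (0 : ℝ≥0∞) < ENNReal.ofReal δ ^ (2 : ℝ) :=
      ENNReal.rpow_pos (ENNReal.ofReal_pos.2 hδ) ENNReal.ofReal_ne_top
    obtain ⟨ε, hlt, hε⟩ := ((hlim.eventually_lt_const hpos).and self_mem_nhdsWithin).exists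
    have hε : 0 < ε := hε
    set T := (finite_image_cellIndex hε hbdd).toFinset with hT
    refine ⟨Submodule.span ℝ ((cellIndicator hε) '' (T : Set (Fin N → ℤ))),
      FiniteDimensional.span_of_finite ℝ (T.finite_toSet.image _), fun u hu => ?_⟩
    obtain ⟨g, hg, hle⟩ := exists_mem_span_cellIndicator hN hε T
      (fun x hx => (Set.Finite.mem_toFinset _).2 ⟨x, hx, rfl⟩) hu
    refine ⟨g, hg, ?_⟩
    have := (ENNReal.rpow_lt_rpow_iff (by norm_num)).1 (hle.trans_lt hlt)
    rw [← ofReal_norm] at this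
    exact (ENNReal.ofReal_lt_ofReal_iff hδ).1 this

end Rellich

/-! ### Completeness of `Y`. -/

section Complete

variable {N : ℕ} {s : ℝ} {Ω : Set (E N)}

theorem exists_seq_tendsto_ae_of_tendsto {w : ℕ → L2 N} {u : L2 N}
    (h : Tendsto w atTop (𝓝 u)) : ∃ ns : ℕ → ℕ, StrictMono ns ∧
      ∀ᵐ x, Tendsto (fun n => w (ns n) x) atTop (𝓝 (u x)) :=
  (tendstoInMeasure_of_tendsto_Lp h).exists_seq_tendsto_ae

/-- The Gagliardo seminorm is lower semicontinuous with respect to convergence in `L²`. -/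
theorem gagliardo_le_of_tendsto {w : ℕ → L2 N} {u : L2 N} (h : Tendsto w atTop (𝓝 u))
    {C : ℝ≥0∞} (hC : ∀ᶠ n in atTop, gagliardo s (w n) ≤ C) : gagliardo s u ≤ C := by
  obtain ⟨ns, hns, hae⟩ := exists_seq_tendsto_ae_of_tendsto h
  have hsq : ∀ v : L2 N, gagliardo s v ≤ C ↔ (∫⁻ p : E N × E N, ‖v p.1 - v p.2‖ₑ ^ (2 : ℝ) /
      ‖p.1 - p.2‖ₑ ^ ((N : ℝ) + 2 * s)) ≤ C ^ (2 : ℝ) := by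
    intro v
    rw [gagliardo, one_div, ENNReal.rpow_inv_le_iff (by norm_num)]
  have hm : ∀ n, Measurable (w n) := fun n => (Lp.stronglyMeasurable (w n)).measurable
  rw [hsq]
  have h1 : ∀ᵐ p : E N × E N, Tendsto (fun n => w (ns n) p.1) atTop (𝓝 (u p.1)) :=
    Measure.quasiMeasurePreserving_fst.ae hae
  have h2 : ∀ᵐ p : E N × E N, Tendsto (fun n => w (ns n) p.2) atTop (𝓝 (u p.2)) :=
    Measure.quasiMeasurePreserving_snd.ae hae
  calc ∫⁻ p : E N × E N, ‖u p.1 - u p.2‖ₑ ^ (2 : ℝ) / ‖p.1 - p.2‖ₑ ^ ((N : ℝ) + 2 * s)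
      ≤ ∫⁻ p : E N × E N, liminf (fun n => ‖w (ns n) p.1 - w (ns n) p.2‖ₑ ^ (2 : ℝ) /
          ‖p.1 - p.2‖ₑ ^ ((N : ℝ) + 2 * s)) atTop := by
        refine lintegral_mono_ae ?_
        filter_upwards [h1, h2] with p hp1 hp2
        -- On the diagonal the denominator may vanish and division need not be continuous, but there
        -- the left side is `0`.
        rcases eq_or_ne p.1 p.2 with hp | hp
        · simp [hp]
        · refine le_of_eq (Tendsto.liminf_eq ?_).symm
          refine ENNReal.Tendsto.div_const
            ((ENNReal.continuous_rpow_const.tendsto _).comp (hp1.sub hp2).enorm) (Or.inr ?_)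
          refine (ENNReal.rpow_pos ?_ enorm_ne_top).ne'
          exact enorm_pos.2 (sub_ne_zero.2 hp)
    _ ≤ liminf (fun n => ∫⁻ p : E N × E N, ‖w (ns n) p.1 - w (ns n) p.2‖ₑ ^ (2 : ℝ) /
          ‖p.1 - p.2‖ₑ ^ ((N : ℝ) + 2 * s)) atTop :=
        lintegral_liminf_le fun n => by
          have := hm (ns n)
          fun_prop
    _ ≤ C ^ (2 : ℝ) := by
        refine liminf_le_of_frequently_le' (Eventually.frequently ?_)
        filter_upwards [hns.tendsto_atTop.eventually hC] with n hn
        exact (hsq _).1 hn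

theorem mem_vanishingOutside_of_tendsto {w : ℕ → L2 N} {u : L2 N} (h : Tendsto w atTop (𝓝 u))
    (hw : ∀ n, w n ∈ vanishingOutside Ω) : u ∈ vanishingOutside Ω := by
  obtain ⟨ns, -, hae⟩ := exists_seq_tendsto_ae_of_tendsto h
  have hall : ∀ᵐ x, ∀ n, x ∉ Ω → w n x = 0 := ae_all_iff.2 hw
  change ∀ᵐ x, x ∉ Ω → u x = 0
  filter_upwards [hae, hall] with x h1 h2 hx
  refine tendsto_nhds_unique h1 ?_
  simp [h2 _ hx]

/-- Poincaré inequality for the Gagliardo seminorm. -/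
theorem exists_norm_le_mul_gagliardo (hN : 1 ≤ N) (hs : 0 < s) (hbdd : Bornology.IsBounded Ω) :
    ∃ C : ℝ, ∀ u ∈ vanishingOutside Ω, gagliardo s u ≠ ⊤ → ‖u‖ ≤ C * (gagliardo s u).toReal := by
  obtain ⟨R, hR0, hR⟩ := hbdd.subset_closedBall_lt 0 0
  -- Since `[u]_s` integrates over `h`, a whole ball of good translations is needed: every `h`
  -- within `1` of `v` satisfies `2 * R < ‖h‖ < 3 * R + 2`.
  obtain ⟨v, hv⟩ := exists_norm_eq_real hN (R := 3 * R + 1) (by positivity)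
  set c : ℝ≥0∞ := volume (Metric.ball v 1) *
    (ENNReal.ofReal (3 * R + 2) ^ ((N : ℝ) + 2 * s))⁻¹ with hc
  have hker : ENNReal.ofReal (3 * R + 2) ^ ((N : ℝ) + 2 * s) ≠ ⊤ :=
    ENNReal.rpow_ne_top_of_nonneg (by positivity) ENNReal.ofReal_ne_top
  have hker0 : ENNReal.ofReal (3 * R + 2) ^ ((N : ℝ) + 2 * s) ≠ 0 :=
    (ENNReal.rpow_pos (ENNReal.ofReal_pos.2 (by positivity)) ENNReal.ofReal_ne_top).ne'
  have hc0 : c ≠ 0 :=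
    mul_ne_zero (Metric.measure_ball_pos volume v one_pos).ne' (ENNReal.inv_ne_zero.2 hker)
  have hct : c ≠ ⊤ :=
    ENNReal.mul_ne_top measure_ball_lt_top.ne (ENNReal.inv_ne_top.2 hker0)
  have key : ∀ u ∈ vanishingOutside Ω, c * ‖u‖ₑ ^ (2 : ℝ) ≤ gagliardo s u ^ (2 : ℝ) := by
    intro u hu
    rw [gagliardo_rpow_two]
    calc c * ‖u‖ₑ ^ (2 : ℝ) = ∫⁻ _h in Metric.ball v 1, ‖u‖ₑ ^ (2 : ℝ) *
          (ENNReal.ofReal (3 * R + 2) ^ ((N : ℝ) + 2 * s))⁻¹ := by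
          rw [setLIntegral_const, hc]
          ring
      _ ≤ ∫⁻ h in Metric.ball v 1, (∫⁻ x, ‖u (x + h) - u x‖ₑ ^ (2 : ℝ)) *
          (‖h‖ₑ ^ ((N : ℝ) + 2 * s))⁻¹ := by
          refine setLIntegral_mono' Metric.isOpen_ball.measurableSet fun h hh => ?_
          rw [mem_ball_iff_norm] at hh
          have h1 : ‖v‖ ≤ ‖h‖ + ‖h - v‖ := by simpa using norm_sub_le h (h - v)
          have h2 : ‖h‖ ≤ ‖h - v‖ + ‖v‖ := by simpa using norm_add_le (h - v) v
          gcongr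
          · exact enorm_rpow_two_le_lintegral_translate hR hu (by linarith)
          · rw [← ofReal_norm]
            exact ENNReal.ofReal_le_ofReal (by linarith)
      _ ≤ _ := setLIntegral_le_lintegral _ _
  refine ⟨(c⁻¹ ^ (1 / 2 : ℝ)).toReal, fun u hu hfin => ?_⟩
  have h1 : ‖u‖ₑ ^ (2 : ℝ) ≤ (c⁻¹ ^ (1 / 2 : ℝ) * gagliardo s u) ^ (2 : ℝ) := by
    rw [ENNReal.mul_rpow_of_nonneg _ _ (by norm_num), ← ENNReal.rpow_mul]
    norm_num only
    rw [ENNReal.rpow_one, ← ENNReal.div_eq_inv_mul, ENNReal.le_div_iff_mul_le (Or.inl hc0)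
      (Or.inl hct), mul_comm]
    exact key u hu
  have h2 := (ENNReal.rpow_le_rpow_iff (by norm_num)).1 h1
  have h3 := ENNReal.toReal_mono (ENNReal.mul_ne_top
    (ENNReal.rpow_ne_top_of_nonneg (by norm_num) (ENNReal.inv_ne_top.2 hc0)) hfin) h2
  rwa [toReal_enorm, ENNReal.toReal_mul] at h3

theorem Y.gagliardo_ne_top (y : Y s Ω) : gagliardo s y.toL2 ≠ ⊤ := ne_of_lt y.2.1

theorem Y.norm_def (y : Y s Ω) : ‖y‖ = (gagliardo s y.toL2).toReal := rfl

theorem Y.norm_le_iff (y : Y s Ω) {ε : ℝ} (hε : 0 ≤ ε) :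
    ‖y‖ ≤ ε ↔ gagliardo s y.toL2 ≤ ENNReal.ofReal ε := by
  rw [Y.norm_def, ENNReal.le_ofReal_iff_toReal_le y.gagliardo_ne_top hε]

theorem Y.toL2_sub (y z : Y s Ω) : (y - z).toL2 = y.toL2 - z.toL2 := rfl

/-- By the Poincaré inequality for `[·]_s`, a Cauchy sequence in `Y` converges in `L²` to some `u`.
Lower semicontinuity, applied to `y n - y m` as `m → ∞`, bounds `[y n - u]_s`; this gives both `u ∈
Y` and convergence in `Y`. -/
theorem Y.completeSpace (hN : 1 ≤ N) (hs : 0 < s) (hbdd : Bornology.IsBounded Ω) :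
    CompleteSpace (Y s Ω) := by
  refine Metric.complete_of_cauchySeq_tendsto fun y hy => ?_
  obtain ⟨C, hC⟩ := exists_norm_le_mul_gagliardo hN hs hbdd
  have hCnorm : ∀ y : Y s Ω, ‖y.toL2‖ ≤ C * ‖y‖ := fun y => hC _ y.2.2 y.gagliardo_ne_top
  let L : Y s Ω →+ L2 N :=
    { toFun := Y.toL2, map_zero' := rfl, map_add' := fun _ _ => rfl }
  have hLu : UniformContinuous L :=
    (AddMonoidHomClass.lipschitz_of_bound L C hCnorm).uniformContinuous
  obtain ⟨u, hu⟩ := cauchySeq_tendsto_of_complete (hLu.comp_cauchySeq hy)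
  have hu : Tendsto (fun n => (y n).toL2) atTop (𝓝 u) := hu
  have hvan : u ∈ vanishingOutside Ω := mem_vanishingOutside_of_tendsto hu fun n => (y n).2.2
  have hlim : ∀ ε > 0, ∃ n₀, ∀ n ≥ n₀, gagliardo s ((y n).toL2 - u : L2 N) ≤ ENNReal.ofReal ε := by
    intro ε hε
    obtain ⟨n₀, hn₀⟩ := Metric.cauchySeq_iff.1 hy ε hε
    refine ⟨n₀, fun n hn => ?_⟩
    refine gagliardo_le_of_tendsto (hu.const_sub (y n).toL2) ?_
    filter_upwards [eventually_ge_atTop n₀] with m hm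
    have := (hn₀ n hn m hm).le
    rwa [dist_eq_norm, Y.norm_le_iff _ hε.le] at this
  have hfin : u ∈ Hs N s := by
    obtain ⟨n₀, hn₀⟩ := hlim 1 one_pos
    have h1 : ((y n₀).toL2 - u) ∈ Hs N s := (hn₀ n₀ le_rfl).trans_lt ENNReal.ofReal_lt_top
    have h2 := (Hs N s).sub_mem (y n₀).2.1 h1
    simpa [Y.toL2] using h2
  obtain ⟨z, hz⟩ : ∃ z : Y s Ω, z.toL2 = u := ⟨⟨u, hfin, hvan⟩, rfl⟩
  refine ⟨z, Metric.tendsto_atTop.2 fun ε hε => ?_⟩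
  obtain ⟨n₀, hn₀⟩ := hlim (ε / 2) (half_pos hε)
  refine ⟨n₀, fun n hn => ?_⟩
  rw [dist_eq_norm]
  refine lt_of_le_of_lt ?_ (half_lt_self hε)
  rw [Y.norm_le_iff _ (half_pos hε).le, Y.toL2_sub, hz]
  exact hn₀ n hn

end Complete

/-! ### The inclusion of `X` in `Y` and its compactness. -/

section Embedding

variable {N : ℕ} {s : ℝ} {Ω : Set (E N)}

theorem H1_le_Hs (hN : 1 ≤ N) (hs : s ∈ Set.Ioo (0 : ℝ) 1) : H1 N ≤ Hs N s := by
  rintro u ⟨G, hG⟩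
  have h := hG.gagliardo_rpow_two_le s 1
  have hfin : gagliardo s u ^ (2 : ℝ) < ⊤ := by
    refine h.trans_lt (ENNReal.add_lt_top.2 ⟨?_, ?_⟩)
    · exact ENNReal.mul_lt_top (setLIntegral_ball_kernel_lt_top hN hs.2)
        (ENNReal.rpow_lt_top_of_nonneg (by norm_num) enorm_ne_top)
    · exact ENNReal.mul_lt_top (setLIntegral_compl_ball_kernel_lt_top hs.1 one_pos)
        (ENNReal.mul_lt_top (by norm_num)
          (ENNReal.rpow_lt_top_of_nonneg (by norm_num) enorm_ne_top))
  exact (ENNReal.rpow_lt_top_iff_of_pos (by norm_num)).1 hfin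

/-- The inclusion `X ⊆ Y` as a linear map. -/
def inclusion (hN : 1 ≤ N) (hs : s ∈ Set.Ioo (0 : ℝ) 1) (Ω : Set (E N)) : X Ω →ₗ[ℝ] Y s Ω where
  toFun u := ⟨u.toL2, H1_le_Hs hN hs u.2.1, u.2.2⟩
  map_add' _ _ := rfl
  map_smul' _ _ := rfl

theorem X.toL2_sub (u v : X Ω) : (u - v).toL2 = u.toL2 - v.toL2 := rfl

theorem X.toL2_mem_gradBall {u : X Ω} (hu : ‖u‖ ≤ 1) : u.toL2 ∈ gradBall Ω :=
  ⟨u.2.2, u.grad, u.isWeakGradient_grad, hu⟩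

/-- On bounded subsets of `X`, smallness in `L²` forces smallness of the Gagliardo seminorm. -/
theorem exists_pos_forall_norm_inclusion_le (hN : 1 ≤ N) (hs : s ∈ Set.Ioo (0 : ℝ) 1) {ε : ℝ}
    (hε : 0 < ε) : ∃ δ > 0, ∀ u : X Ω, ‖u‖ ≤ 2 → ‖u.toL2‖ < δ → ‖inclusion hN hs Ω u‖ ≤ ε := by
  have hη : (0 : ℝ≥0∞) < ENNReal.ofReal ε ^ (2 : ℝ) / 2 :=
    ENNReal.div_pos (ENNReal.rpow_pos (ENNReal.ofReal_pos.2 hε) ENNReal.ofReal_ne_top).ne'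
      (by norm_num)
  -- The factor `2 ^ 2` comes from `‖u‖ ≤ 2`, the bound for a difference of two elements of the unit
  -- ball. The radius `r` is fixed before `δ`, because the far-field constant `B` depends on `r`.
  have hA : Tendsto (fun r : ℝ => (∫⁻ h : E N in Metric.ball 0 r,
      ‖h‖ₑ ^ (2 : ℝ) / ‖h‖ₑ ^ ((N : ℝ) + 2 * s)) * 2 ^ (2 : ℝ)) (𝓝[>] 0) (𝓝 0) := by
    simpa using ENNReal.Tendsto.mul_const (tendsto_setLIntegral_ball_kernel hN hs.2)
      (b := 2 ^ (2 : ℝ)) (Or.inr (by norm_num))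
  obtain ⟨r, hr, hr0⟩ := ((hA.eventually_lt_const hη).and self_mem_nhdsWithin).exists
  set B := ∫⁻ h : E N in (Metric.ball 0 r)ᶜ, (‖h‖ₑ ^ ((N : ℝ) + 2 * s))⁻¹
  have hB : B ≠ ⊤ := (setLIntegral_compl_ball_kernel_lt_top hs.1 hr0).ne
  have hBlim : Tendsto (fun δ : ℝ => B * (4 * ENNReal.ofReal δ ^ (2 : ℝ))) (𝓝[>] 0) (𝓝 0) := by
    have h1 : Continuous (fun ε : ℝ => ENNReal.ofReal ε ^ (2 : ℝ)) :=
      ENNReal.continuous_rpow_const.comp ENNReal.continuous_ofReal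
    have h2 : Tendsto (fun ε : ℝ => ENNReal.ofReal ε ^ (2 : ℝ)) (𝓝[>] 0) (𝓝 0) := by
      simpa using (h1.tendsto 0).mono_left nhdsWithin_le_nhds
    have h3 := ENNReal.Tendsto.const_mul h2 (a := 4) (Or.inr (by norm_num))
    simpa using ENNReal.Tendsto.const_mul h3 (Or.inr hB)
  obtain ⟨δ, hδ, hδ0⟩ := ((hBlim.eventually_lt_const hη).and self_mem_nhdsWithin).exists
  refine ⟨δ, hδ0, fun u hu2 huδ => ?_⟩
  rw [Y.norm_le_iff _ hε.le]
  refine (ENNReal.rpow_le_rpow_iff (by norm_num : (0 : ℝ) < 2)).1 ?_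
  refine (u.isWeakGradient_grad.gagliardo_rpow_two_le s r).trans ?_
  rw [← ENNReal.add_halves (ENNReal.ofReal ε ^ (2 : ℝ))]
  refine add_le_add (le_trans ?_ hr.le) (le_trans ?_ hδ.le)
  · gcongr
    rw [← ofReal_norm]
    exact ENNReal.ofReal_le_of_le_toReal hu2
  · gcongr
    rw [← ofReal_norm]
    exact ENNReal.ofReal_le_ofReal huδ.le

/-- A `δ`-net for the `L²` distance is an `ε`-net for the distance of `Y`, by the preceding estimate
applied to differences. -/
theorem totallyBounded_image_inclusion (hN : 1 ≤ N) (hs : s ∈ Set.Ioo (0 : ℝ) 1)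
    (hbdd : Bornology.IsBounded Ω) :
    TotallyBounded (inclusion hN hs Ω '' Metric.closedBall 0 1) := by
  refine Metric.totallyBounded_iff.2 fun ε hε => ?_
  obtain ⟨δ, hδ0, hδ⟩ := exists_pos_forall_norm_inclusion_le (Ω := Ω) hN hs (half_pos hε)
  have htb : TotallyBounded (X.toL2 '' Metric.closedBall (0 : X Ω) 1) := by
    refine (totallyBounded_gradBall hN hbdd).subset ?_
    rintro _ ⟨u, hu, rfl⟩
    exact X.toL2_mem_gradBall (by simpa using hu)
  -- The centres are taken inside the set, so that they lift to the unit ball of `X`.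
  obtain ⟨t, hts, htf, hcov⟩ := Metric.finite_approx_of_totallyBounded htb δ hδ0
  have hts' : ∀ v ∈ t, ∃ w : X Ω, w ∈ Metric.closedBall 0 1 ∧ w.toL2 = v := hts
  choose! f hf hft using hts'
  refine ⟨(fun v => inclusion hN hs Ω (f v)) '' t, htf.image _, ?_⟩
  rintro _ ⟨u, hu, rfl⟩
  have hmem := hcov ⟨u, hu, rfl⟩
  simp only [Set.mem_iUnion, Metric.mem_ball] at hmem
  obtain ⟨v, hv, hdist⟩ := hmem
  simp only [Set.mem_iUnion, Metric.mem_ball]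
  refine ⟨_, ⟨v, hv, rfl⟩, ?_⟩
  rw [dist_eq_norm, ← map_sub]
  refine lt_of_le_of_lt (hδ _ ?_ ?_) (half_lt_self hε)
  · have h1 : ‖u‖ ≤ 1 := by simpa using hu
    have h2 : ‖f v‖ ≤ 1 := by simpa using hf v hv
    linarith [norm_sub_le u (f v)]
  · rwa [X.toL2_sub, hft v hv, ← dist_eq_norm]

theorem isCompactOperator_inclusion (hN : 1 ≤ N) (hs : s ∈ Set.Ioo (0 : ℝ) 1)
    (hbdd : Bornology.IsBounded Ω) : IsCompactOperator (inclusion hN hs Ω) := by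
  have := Y.completeSpace (Ω := Ω) hN hs.1 hbdd
  refine ⟨closure (inclusion hN hs Ω '' Metric.closedBall 0 1),
    (totallyBounded_image_inclusion hN hs hbdd).closure.isCompact_of_isClosed isClosed_closure, ?_⟩
  filter_upwards [Metric.closedBall_mem_nhds (0 : X Ω) one_pos] with u hu
  exact subset_closure ⟨u, hu, rfl⟩

end Embedding

end MixedSobolev

end

theorem lemma1 (N : ℕ) (hN : 2 ≤ N) (s : ℝ) (hs : s ∈ Set.Ioo (0 : ℝ) 1)
    (Ω : Set (MixedSobolev.E N)) (hopen : IsOpen Ω) (hconn : IsConnected Ω)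
    (hbdd : Bornology.IsBounded Ω) :
    ∃ ι : MixedSobolev.X Ω →L[ℝ] MixedSobolev.Y s Ω,
      (∀ u : MixedSobolev.X Ω, (ι u).toL2 = u.toL2) ∧ IsCompactOperator ι := by
  have h := MixedSobolev.isCompactOperator_inclusion (by omega : 1 ≤ N) hs hbdd
  -- A compact linear map is continuous: it sends a neighbourhood of `0` into a compact, hence
  -- bounded, set.
  exact ⟨ContinuousLinearMap.mkOfIsCompactOperator h, fun _ => rfl, h⟩
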